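/- \textbf{Theorem (universal sum rules).} Let $S=\{a_k\}_{k\in\mathbb N}$ be a sequence of complex numbers (indexed by $k=1,2,\dots$) with $0<|a_1|\le|a_2|\le\cdots\to\infty$ whose exponent of convergence $\alpha=\limsup_{k\to\infty}\frac{\ln k}{\ln|a_k|}$ is finite. Let $\zeta_S(s)=\sum_{k=1}^\infty a_k^{-s}$ for $\Re(s)>\alpha$, where the powers are formed with a logarithm cut along the ray $\{te^{i\Psi}:t\ge0\}$ for some $\Psi\in\mathbb R$; at integers $s=n$ this is $\sum_k a_k^{-n}$, whatever $\Psi$ is. Let $F$ be a characteristic function of $S$ of minimal order, that is, an entire function whose zeros, counted with multiplicity, are exactly the points $a_k$, and whose growth order $\limsup_{r\to\infty}\frac{\ln\ln \max_{|z|=r}|F(z)|}{\ln r}$ equals that of the Hadamard product $$H(z)=\prod_{k=1}^\infty\Big(1-\frac z{a_k}\Big)\exp\Big[\sum_{j=1}^{\lfloor\alpha\rfloor}\frac1j\Big(\frac z{a_k}\Big)^j\Big].$$ Write $F(z)=\sum_{j=0}^\infty c_jz^j$ and define $$b_1=\frac{c_1}{c_0},\qquad b_j=\frac{c_j}{c_0}-\sum_{\ell=1}^{j-1}\frac{\ell}{j}\,\frac{c_{j-\ell}}{c_0}\,b_\ell\quad(j\ge2).$$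 Then for every $n\in\mathbb N=\{1,2,\dots\}$ with $n>\alpha$ the series defining $\zeta_S(n)$ converges absolutely, $$\zeta_S(n)=-\operatorname{Res}\Big[z^{-n}\frac{F'(z)}{F(z)};\ z=0\Big]=-n\,b_n,$$ and consequently $$\zeta_S(n)=-n\frac{c_n}{c_0}-\sum_{\ell=\lfloor\alpha\rfloor+1}^{n-1}\frac{c_{n-\ell}}{c_0}\,\zeta_S(\ell)+\sum_{\ell=1}^{\lfloor\alpha\rfloor}\ell\,\frac{c_{n-\ell}}{c_0}\,b_\ell .$$ In particular, if $\alpha<1$, then for every $n\in\mathbb N$ $$\zeta_S(n)=-n\frac{c_n}{c_0}-\sum_{\ell=1}^{n-1}\frac{c_{n-\ell}}{c_0}\,\zeta_S(\ell).$$ -/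

import Mathlib

open Filter Topology

noncomputable section

namespace ZetaSumRules

/-- Exponent of convergence `limsup (ln n) / (ln |a_n|)`, as an extended real number.
Sequences are indexed from `0` here, so `a k` is the `(k+1)`-st term. -/
def convergenceExponent (a : ℕ → ℂ) : EReal :=
  limsup (fun k : ℕ => ((Real.log ((k : ℝ) + 1) / Real.log ‖a k‖ : ℝ) : EReal)) atTop

/-- `0 < |a_1| ≤ |a_2| ≤ ⋯ → ∞`, with finite exponent of convergence `α`.
No ray free of the points `a_k` is required. -/
structure IsZetaSequence (a : ℕ → ℂ) (α : ℝ) : Prop where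
  pos : 0 < ‖a 0‖
  mono : Monotone fun k => ‖a k‖
  tendsto : Tendsto (fun k => ‖a k‖) atTop atTop
  exponent : convergenceExponent a = (α : EReal)

/-- The power `w ^ s` formed with the logarithm whose branch cut is the ray
`{t e^{iΨ} : t ≥ 0}`, the argument being taken in `(Ψ - 2π, Ψ]`. -/
def branchPow (Ψ : ℝ) (w s : ℂ) : ℂ :=
  Complex.exp (s * (Complex.log (w * Complex.exp (-(((Ψ - Real.pi : ℝ) : ℂ) * Complex.I))) +
    ((Ψ - Real.pi : ℝ) : ℂ) * Complex.I))

/-- The `ζ`-function `ζ_S(s) = ∑ a_k ^ (-s)`, for the branch cut at angle `Ψ`. -/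
def zeta (Ψ : ℝ) (a : ℕ → ℂ) (s : ℂ) : ℂ :=
  ∑' k, branchPow Ψ (a k) (-s)

/-- At integers the branch does not matter. -/
theorem branchPow_neg_natCast (Ψ : ℝ) {w : ℂ} (hw : w ≠ 0) (n : ℕ) :
    branchPow Ψ w (-(n : ℂ)) = (w ^ n)⁻¹ := by
  have h0 : w * Complex.exp (-(((Ψ - Real.pi : ℝ) : ℂ) * Complex.I)) ≠ 0 :=
    mul_ne_zero hw (Complex.exp_ne_zero _)
  rw [branchPow, neg_mul, Complex.exp_neg, Complex.exp_nat_mul, Complex.exp_add,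
    Complex.exp_log h0, mul_assoc, ← Complex.exp_add, neg_add_cancel, Complex.exp_zero, mul_one]

/-- The Weierstrass elementary factor `E(w, p) = (1 - w) exp (∑_{j=1}^{p} w^j / j)`. -/
def elementaryFactor (p : ℕ) (w : ℂ) : ℂ :=
  (1 - w) * Complex.exp (∑ j ∈ Finset.Icc 1 p, w ^ j / (j : ℂ))

/-- The Hadamard characteristic function `∏ E(z / a_k, p)`. -/
def hadamardProduct (p : ℕ) (a : ℕ → ℂ) (z : ℂ) : ℂ :=
  ∏' k, elementaryFactor p (z / a k)

/-- The maximum modulus `M(r) = sup_{|z| = r} |F z|`. -/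
def maxModulus (F : ℂ → ℂ) (r : ℝ) : ℝ :=
  sSup ((fun z => ‖F z‖) '' Metric.sphere 0 r)

/-- The growth order `limsup_{r → ∞} (ln ln M(r)) / (ln r)` of an entire function. -/
def growthOrder (F : ℂ → ℂ) : EReal :=
  limsup (fun r : ℝ => ((Real.log (Real.log (maxModulus F r)) / Real.log r : ℝ) : EReal)) atTop

/-- `F` is a characteristic function of the sequence: it is entire, and its zeros are the points
`a_k`, counted with multiplicity. -/
structure IsCharacteristicFunction (F : ℂ → ℂ) (a : ℕ → ℂ) : Prop where
  entire : Differentiable ℂ F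
  zeros : ∀ z, analyticOrderAt F z = {k | a k = z}.encard

/-- `F` has minimal growth order: the order of the Hadamard characteristic function, whose
genus parameter is `⌊α⌋`. -/
def HasMinimalOrder (F : ℂ → ℂ) (a : ℕ → ℂ) (α : ℝ) : Prop :=
  growthOrder F = growthOrder (hadamardProduct ⌊α⌋₊ a)

/-- `f` has an isolated singularity (or is regular) at `z₀`, with residue `R` there. -/
def HasResidueAt (f : ℂ → ℂ) (z₀ R : ℂ) : Prop :=
  ∃ ρ : ℝ, 0 < ρ ∧ DifferentiableOn ℂ f (Metric.ball z₀ ρ \ {z₀}) ∧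
    ∀ r : ℝ, 0 < r → r < ρ →
      (2 * (Real.pi : ℂ) * Complex.I)⁻¹ * (∮ z in C(z₀, r), f z) = R

/-- The coefficients `b_j`, `j ≥ 1` (the value at `j = 0` is irrelevant). -/
def sumRuleCoeff (c : ℕ → ℂ) (j : ℕ) : ℂ :=
  c j / c 0 - ∑ l ∈ (Finset.Ico 1 j).attach,
    ((l.1 : ℂ) / (j : ℂ)) * (c (j - l.1) / c 0) * sumRuleCoeff c l.1
termination_by j
decreasing_by exact (Finset.mem_Ico.mp l.2).2

theorem sumRuleCoeff_one (c : ℕ → ℂ) : sumRuleCoeff c 1 = c 1 / c 0 := by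
  rw [sumRuleCoeff]
  have : (Finset.Ico 1 1).attach = (∅ : Finset {x // x ∈ Finset.Ico 1 1}) := by simp
  rw [this]; simp

theorem sumRuleCoeff_eq (c : ℕ → ℂ) (j : ℕ) :
    sumRuleCoeff c j = c j / c 0 - ∑ l ∈ Finset.Ico 1 j,
      ((l : ℂ) / (j : ℂ)) * (c (j - l) / c 0) * sumRuleCoeff c l := by
  rw [sumRuleCoeff]
  congr 1
  exact Finset.sum_attach (Finset.Ico 1 j)
    (fun l => ((l : ℂ) / (j : ℂ)) * (c (j - l) / c 0) * sumRuleCoeff c l)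

end ZetaSumRules

end

/-!
Near the origin `F' / F` is holomorphic, and its Taylor coefficient of index `m` is
`(m + 1) * b_{m+1}`, because the recurrence defining the `b_j` is the comparison of coefficients in
`F' = (F' / F) * F` (`iteratedDeriv_logDeriv_eq_sumRuleCoeff`). It is also the residue of
`z ^ (-(m + 1)) * F' / F`. The analytic content is that for `m + 1 > α` this coefficient equals
`-∑ a_k ^ (-(m + 1))` (`IsCharacteristicFunction.iteratedDeriv_logDeriv_eq`).

Neither the Hadamard factorization of `F` nor a lower bound for the canonical product is needed for
that. Write `F z = ∏_{k < N} (z - a_k) * g z`, where `g` is zero-free on the disc `|z| < |a_N|`.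
The coefficients of `F' / F` and `g' / g` differ by `-∑_{k < N} a_k ^ (-(m + 1))`. On the circle of
radius `2 * |a_N|` the quotient `|g z / g 0|` is at most `|F z / F 0|`, hence by Borel–Carathéodory
and Cauchy's estimate the coefficient of `g' / g` is `O((log M(2 |a_N|) + 1) / |a_N| ^ (m + 1))`.
This tends to zero as soon as the growth order of `F` is less than `⌊α⌋ + 1 ≤ m + 1`.

The growth order of `F` is by hypothesis that of the Hadamard product, so it remains to see that
the latter is less than `⌊α⌋ + 1` (`IsZetaSequence.growthOrder_hadamardProduct_lt`): for `σ`
strictly between `α` and `⌊α⌋ + 1` the elementary factors satisfy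
`|E(w, ⌊α⌋)| ≤ exp (C * |w| ^ σ)`, and `∑ |a_k| ^ (-σ)` converges.
-/

namespace ZetaSumRules

/-! ### Elementary factors -/

theorem hasDerivAt_elementaryFactor (p : ℕ) (w : ℂ) :
    HasDerivAt (elementaryFactor p)
      (-(w ^ p * Complex.exp (∑ j ∈ Finset.Icc 1 p, w ^ j / (j : ℂ)))) w := by
  have hsum : HasDerivAt (fun w : ℂ => ∑ j ∈ Finset.Icc 1 p, w ^ j / (j : ℂ))
      (∑ j ∈ Finset.Icc 1 p, w ^ (j - 1)) w := by
    refine HasDerivAt.fun_sum fun j hj => ?_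
    have hj0 : (j : ℂ) ≠ 0 := by
      have := (Finset.mem_Icc.mp hj).1
      exact_mod_cast (by omega : j ≠ 0)
    refine ((hasDerivAt_pow j w).div_const (j : ℂ)).congr_deriv ?_
    field_simp
  have hgeom : (1 - w) * ∑ j ∈ Finset.Icc 1 p, w ^ (j - 1) = 1 - w ^ p := by
    rw [← mul_neg_geom_sum w p, Finset.range_eq_Ico]
    congr 1
    rw [← Finset.Ico_add_one_right_eq_Icc, Finset.sum_Ico_eq_sum_range, Finset.range_eq_Ico]
    simp
  have h := ((hasDerivAt_id w).const_sub 1).mul hsum.cexp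
  refine h.congr_deriv ?_
  simp only [id]
  linear_combination Complex.exp (∑ j ∈ Finset.Icc 1 p, w ^ j / (j : ℂ)) * hgeom

theorem differentiable_elementaryFactor (p : ℕ) : Differentiable ℂ (elementaryFactor p) :=
  fun w => (hasDerivAt_elementaryFactor p w).differentiableAt

theorem elementaryFactor_zero_right (p : ℕ) : elementaryFactor p 0 = 1 := by
  have : ∑ j ∈ Finset.Icc 1 p, (0 : ℂ) ^ j / (j : ℂ) = 0 :=
    Finset.sum_eq_zero fun j hj => by
      rw [zero_pow (by have := (Finset.mem_Icc.mp hj).1; omega), zero_div]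
  simp [elementaryFactor, this]

theorem norm_sum_pow_div_le {p : ℕ} {w : ℂ} {B : ℝ} (hB : ∀ j ∈ Finset.Icc 1 p, ‖w‖ ^ j ≤ B) :
    ‖∑ j ∈ Finset.Icc 1 p, w ^ j / (j : ℂ)‖ ≤ p * B := by
  refine (norm_sum_le_of_le (Finset.Icc 1 p) (f := fun j => w ^ j / (j : ℂ)) (n := fun _ => B)
    fun j hj => ?_).trans ?_
  · have h1 : (1 : ℝ) ≤ j := by exact_mod_cast (Finset.mem_Icc.mp hj).1
    rw [norm_div, norm_pow, Complex.norm_natCast]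
    exact (div_le_self (by positivity) h1).trans (hB j hj)
  · simp

/-- The elementary factor agrees with `1` to order `p + 1` at the origin: its derivative is
`-w ^ p` times an exponential, and the mean value inequality applies. -/
theorem norm_elementaryFactor_sub_one_le (p : ℕ) {w : ℂ} (hw : ‖w‖ ≤ 1) :
    ‖elementaryFactor p w - 1‖ ≤ Real.exp p * ‖w‖ ^ (p + 1) := by
  have h := (convex_closedBall (0 : ℂ) ‖w‖).norm_image_sub_le_of_norm_hasDerivWithin_le
    (f := elementaryFactor p) (C := ‖w‖ ^ p * Real.exp p)
    (fun z _ => (hasDerivAt_elementaryFactor p z).hasDerivWithinAt) (fun z hz => ?_)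
    (Metric.mem_closedBall_self (norm_nonneg w)) (y := w) (by simp)
  · rw [elementaryFactor_zero_right, sub_zero] at h
    refine h.trans_eq (by ring)
  · have hz' : ‖z‖ ≤ ‖w‖ := by simpa using hz
    rw [norm_neg, norm_mul, norm_pow]
    gcongr
    refine (Complex.norm_exp_le_exp_norm _).trans (Real.exp_le_exp.mpr ?_)
    have := norm_sum_pow_div_le (p := p) (w := z) (B := 1)
      fun j _ => pow_le_one₀ (norm_nonneg z) (hz'.trans hw)
    simpa using this

/-- Near the origin the factor is `1 + O(w ^ (p + 1))`, far from it the exponential of a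
polynomial of degree `p` dominates; any exponent `σ > 0` in `[p, p + 1]` covers both regimes. -/
theorem norm_elementaryFactor_le (p : ℕ) {σ : ℝ} (hσ : 0 < σ) (hpσ : p ≤ σ) (hσp : σ ≤ p + 1)
    (w : ℂ) :
    ‖elementaryFactor p w‖ ≤ Real.exp ((Real.exp p + (1 + 1 / σ) + p) * ‖w‖ ^ σ) := by
  have hx0 : 0 ≤ ‖w‖ ^ σ := by positivity
  rcases le_total ‖w‖ 1 with hw | hw
  · have h1 := norm_elementaryFactor_sub_one_le p hw
    have h2 : ‖w‖ ^ (p + 1) ≤ ‖w‖ ^ σ := by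
      rcases (norm_nonneg w).eq_or_lt with h0 | h0
      · rw [← h0, zero_pow (by omega)]; positivity
      · rw [← Real.rpow_natCast]
        exact Real.rpow_le_rpow_of_exponent_ge h0 hw (by push_cast; exact hσp)
    calc ‖elementaryFactor p w‖ ≤ ‖elementaryFactor p w - 1‖ + 1 := by
          simpa using norm_add_le (elementaryFactor p w - 1) 1
      _ ≤ Real.exp p * ‖w‖ ^ σ + 1 := by
          gcongr
          exact h1.trans (by gcongr)
      _ ≤ Real.exp (Real.exp p * ‖w‖ ^ σ) := Real.add_one_le_exp _
      _ ≤ _ := by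
          gcongr
          have : 0 < 1 / σ := by positivity
          have : (0 : ℝ) ≤ p := by positivity
          linarith
  · have hx1 : 1 ≤ ‖w‖ ^ σ := Real.one_le_rpow hw hσ.le
    have h1 : ‖1 - w‖ ≤ Real.exp ((1 + 1 / σ) * ‖w‖ ^ σ) := by
      have hlog : ‖w‖ ≤ Real.exp (‖w‖ ^ σ / σ) := by
        rw [← Real.log_le_iff_le_exp (by linarith)]
        exact Real.log_le_rpow_div (norm_nonneg w) hσ
      calc ‖1 - w‖ ≤ 1 + ‖w‖ := by simpa using norm_sub_le (1 : ℂ) w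
        _ ≤ 2 * ‖w‖ := by linarith
        _ ≤ Real.exp 1 * Real.exp (‖w‖ ^ σ / σ) := by
            gcongr
            have := Real.add_one_le_exp 1
            linarith
        _ ≤ Real.exp ((1 + 1 / σ) * ‖w‖ ^ σ) := by
            rw [← Real.exp_add, add_mul]
            refine Real.exp_le_exp.mpr
              (add_le_add (by linarith) (by rw [div_mul_eq_mul_div, one_mul]))
    have h2 : ‖Complex.exp (∑ j ∈ Finset.Icc 1 p, w ^ j / (j : ℂ))‖
        ≤ Real.exp (p * ‖w‖ ^ σ) := by
      refine (Complex.norm_exp_le_exp_norm _).trans (Real.exp_le_exp.mpr ?_)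
      refine norm_sum_pow_div_le fun j hj => ?_
      rw [← Real.rpow_natCast]
      exact Real.rpow_le_rpow_of_exponent_le hw
        ((Nat.cast_le.mpr (Finset.mem_Icc.mp hj).2).trans hpσ)
    rw [elementaryFactor, norm_mul]
    calc _ ≤ Real.exp ((1 + 1 / σ) * ‖w‖ ^ σ) * Real.exp (p * ‖w‖ ^ σ) := by gcongr
      _ = Real.exp (((1 + 1 / σ) + p) * ‖w‖ ^ σ) := by rw [← Real.exp_add]; ring_nf
      _ ≤ _ := by
        refine Real.exp_le_exp.mpr (mul_le_mul_of_nonneg_right ?_ hx0)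
        have := Real.exp_pos p
        linarith

/-! ### Growth of the Hadamard product -/

variable {a : ℕ → ℂ} {α : ℝ}

theorem IsZetaSequence.norm_pos (ha : IsZetaSequence a α) (k : ℕ) : 0 < ‖a k‖ :=
  ha.pos.trans_le (ha.mono (Nat.zero_le k))

theorem IsZetaSequence.ne_zero (ha : IsZetaSequence a α) (k : ℕ) : a k ≠ 0 :=
  norm_pos_iff.mp (ha.norm_pos k)

theorem IsZetaSequence.exponent_nonneg (ha : IsZetaSequence a α) : 0 ≤ α := by
  have h : (0 : EReal) ≤ convergenceExponent a := by
    refine le_limsup_of_frequently_le (Eventually.frequently ?_) (by isBoundedDefault)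
    filter_upwards [ha.tendsto.eventually_ge_atTop 1] with k hk
    have h1 := Real.log_nonneg hk
    have h2 : 0 ≤ Real.log ((k : ℝ) + 1) := Real.log_nonneg (by linarith [k.cast_nonneg (α := ℝ)])
    exact_mod_cast div_nonneg h2 h1
  rw [ha.exponent] at h
  exact_mod_cast h

/-- Beyond the exponent of convergence one has `k + 1 ≤ |a_k| ^ τ` eventually, so that the series
is dominated by `∑ (k + 1) ^ (-σ / τ)`. -/
theorem IsZetaSequence.summable_rpow (ha : IsZetaSequence a α) {σ : ℝ} (hσ : α < σ) :
    Summable fun k => ‖a k‖ ^ (-σ) := by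
  obtain ⟨τ, hατ, hτσ⟩ := exists_between hσ
  have hτ : 0 < τ := ha.exponent_nonneg.trans_lt hατ
  have hs : Summable fun k : ℕ => ((k : ℝ) + 1) ^ (-(σ / τ)) := by
    have := (summable_nat_add_iff 1).mpr
      (Real.summable_nat_rpow.mpr (show -(σ / τ) < -1 by
        rw [neg_lt_neg_iff, one_lt_div hτ]; exact hτσ))
    simpa using this
  have hev : ∀ᶠ k : ℕ in atTop, Real.log ((k : ℝ) + 1) / Real.log ‖a k‖ < τ := by
    have : convergenceExponent a < (τ : EReal) := by
      rw [ha.exponent]; exact_mod_cast hατ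
    filter_upwards [eventually_lt_of_limsup_lt this] with k hk
    exact_mod_cast hk
  refine hs.of_norm_bounded_eventually_nat ?_
  filter_upwards [hev, ha.tendsto.eventually_gt_atTop 1] with k hk h1
  rw [Real.norm_of_nonneg (by positivity)]
  have hk0 : (0 : ℝ) < (k : ℝ) + 1 := by positivity
  have hle : (k : ℝ) + 1 ≤ ‖a k‖ ^ τ := by
    rw [← Real.log_le_log_iff hk0 (by positivity), Real.log_rpow (by linarith)]
    exact ((div_lt_iff₀ (Real.log_pos h1)).mp hk).le
  have : ‖a k‖ ^ (-σ) = (‖a k‖ ^ τ) ^ (-(σ / τ)) := by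
    rw [← Real.rpow_mul (norm_nonneg _)]
    congr 1
    field_simp
  rw [this]
  exact Real.rpow_le_rpow_of_nonpos hk0 hle (by
    have : 0 < σ / τ := div_pos (hτ.trans hτσ) hτ
    linarith)

theorem IsZetaSequence.differentiable_hadamardProduct (ha : IsZetaSequence a α) :
    Differentiable ℂ (hadamardProduct ⌊α⌋₊ a) := by
  set p := ⌊α⌋₊
  have hsum : Summable fun k => ‖a k‖ ^ (-((p : ℝ) + 1)) :=
    ha.summable_rpow (Nat.lt_floor_add_one α)
  have key (R : ℝ) : DifferentiableOn ℂ (hadamardProduct p a) (Metric.ball 0 R) := by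
    rcases le_or_gt R 0 with hR | hR
    · rw [Metric.ball_eq_empty.mpr hR]
      exact differentiableOn_empty
    have h := (hsum.mul_left (Real.exp p * R ^ (p + 1))).hasProdLocallyUniformlyOn_nat_one_add
      (K := Metric.ball (0 : ℂ) R)
      (f := fun k z => elementaryFactor p (z / a k) - 1) Metric.isOpen_ball ?_ ?_
    · refine DifferentiableOn.congr (f := fun z => ∏' k, (1 + (elementaryFactor p (z / a k) - 1)))
        ?_ fun z _ => by simp [hadamardProduct]
      refine TendstoLocallyUniformlyOn.differentiableOn h
        (Eventually.of_forall fun s => ?_) Metric.isOpen_ball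
      refine Differentiable.differentiableOn ?_
      refine Differentiable.fun_finsetProd fun k _ => ?_
      exact (((differentiable_elementaryFactor p).comp
        (differentiable_id.div_const (a k))).sub_const 1).const_add 1
    · filter_upwards [ha.tendsto.eventually_ge_atTop R] with k hk z hz
      have hz : ‖z‖ < R := by simpa using hz
      have hw : ‖z / a k‖ ≤ 1 := by
        rw [norm_div, div_le_one (ha.norm_pos k)]
        exact hz.le.trans hk
      refine (norm_elementaryFactor_sub_one_le p hw).trans ?_
      rw [norm_div, div_pow, Real.rpow_neg (norm_nonneg _), mul_assoc, ← div_eq_mul_inv]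
      have : ‖a k‖ ^ ((p : ℝ) + 1) = ‖a k‖ ^ (p + 1) := by
        rw [← Real.rpow_natCast]; push_cast; rfl
      rw [this]
      gcongr
    · intro k
      exact (((differentiable_elementaryFactor p).comp
        (differentiable_id.div_const (a k))).sub_const 1).continuous.continuousOn
  intro z
  exact (key (‖z‖ + 1)).differentiableAt (Metric.isOpen_ball.mem_nhds (by simp))

theorem IsZetaSequence.exists_norm_hadamardProduct_le (ha : IsZetaSequence a α) {σ : ℝ}
    (hασ : α < σ) (hσp : σ ≤ ⌊α⌋₊ + 1) :
    ∃ C : ℝ, 0 ≤ C ∧ ∀ z, ‖hadamardProduct ⌊α⌋₊ a z‖ ≤ Real.exp (C * ‖z‖ ^ σ) := by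
  have hσ : 0 < σ := ha.exponent_nonneg.trans_lt hασ
  have hpσ : (⌊α⌋₊ : ℝ) ≤ σ := (Nat.floor_le ha.exponent_nonneg).trans hασ.le
  set p := ⌊α⌋₊
  set D : ℝ := Real.exp p + (1 + 1 / σ) + p
  have hD : 0 ≤ D := by positivity
  have hsum := ha.summable_rpow hασ
  have hC : 0 ≤ D * ∑' k, ‖a k‖ ^ (-σ) := mul_nonneg hD (tsum_nonneg fun k => by positivity)
  refine ⟨D * ∑' k, ‖a k‖ ^ (-σ), hC, fun z => ?_⟩
  by_cases hm : Multipliable fun k => elementaryFactor p (z / a k)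
  swap
  · -- the default value `1` of a divergent product obeys the bound as well
    rw [hadamardProduct, tprod_eq_one_of_not_multipliable hm, norm_one]
    exact Real.one_le_exp (by positivity)
  refine le_of_tendsto hm.hasProd.norm (Eventually.of_forall fun s => ?_)
  calc ∏ k ∈ s, ‖elementaryFactor p (z / a k)‖
      ≤ ∏ k ∈ s, Real.exp (D * ‖z‖ ^ σ * ‖a k‖ ^ (-σ)) := by
        refine Finset.prod_le_prod (fun _ _ => norm_nonneg _) fun k _ => ?_
        refine (norm_elementaryFactor_le p hσ hpσ hσp _).trans_eq ?_
        rw [norm_div, Real.div_rpow (norm_nonneg _) (norm_nonneg _),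
          Real.rpow_neg (norm_nonneg _), mul_assoc, ← div_eq_mul_inv (‖z‖ ^ σ)]
    _ = Real.exp (D * ‖z‖ ^ σ * ∑ k ∈ s, ‖a k‖ ^ (-σ)) := by
        rw [← Real.exp_sum, Finset.mul_sum]
    _ ≤ Real.exp (D * (∑' k, ‖a k‖ ^ (-σ)) * ‖z‖ ^ σ) := by
        rw [mul_right_comm]
        gcongr
        exact hsum.sum_le_tsum s fun k _ => by positivity

theorem norm_le_maxModulus {F : ℂ → ℂ} (hF : Continuous F) (z : ℂ) :
    ‖F z‖ ≤ maxModulus F ‖z‖ :=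
  le_csSup ((isCompact_sphere (0 : ℂ) ‖z‖).image hF.norm).bddAbove ⟨z, by simp, rfl⟩

theorem norm_le_maxModulus_of_norm_le {F : ℂ → ℂ} (hF : Differentiable ℂ F) {z : ℂ} {r : ℝ}
    (hr : 0 < r) (hz : ‖z‖ ≤ r) : ‖F z‖ ≤ maxModulus F r := by
  refine Complex.norm_le_of_forall_mem_frontier_norm_le (U := Metric.ball 0 r)
    Metric.isBounded_ball hF.diffContOnCl (fun w hw => ?_)
    (by rw [closure_ball _ hr.ne']; simpa using hz)
  rw [frontier_ball _ hr.ne'] at hw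
  have : ‖w‖ = r := by simpa using hw
  exact this ▸ norm_le_maxModulus hF.continuous w

/-- A function of order less than `β` has `M(r) ≤ exp (r ^ β)` for large `r`. The conventions for
`Real.log` at non-positive numbers do no harm: where `M(r) ≤ 0` or `log M(r) ≤ 0` the bound is
trivial. -/
theorem eventually_maxModulus_le {F : ℂ → ℂ} {β : ℝ} (h : growthOrder F < (β : EReal)) :
    ∀ᶠ r in atTop, maxModulus F r ≤ Real.exp (r ^ β) := by
  filter_upwards [eventually_lt_of_limsup_lt h, eventually_gt_atTop 1] with r hr h1
  have hr' : Real.log (Real.log (maxModulus F r)) / Real.log r < β := by exact_mod_cast hr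
  rw [div_lt_iff₀ (Real.log_pos h1), ← Real.log_rpow (by linarith)] at hr'
  have hpos : 0 < r ^ β := Real.rpow_pos_of_pos (by linarith) _
  have hlog : Real.log (maxModulus F r) ≤ r ^ β := by
    rcases le_or_gt (Real.log (maxModulus F r)) 0 with h0 | h0
    · exact h0.trans hpos.le
    · exact ((Real.log_lt_log_iff h0 hpos).mp hr').le
  rcases le_or_gt (maxModulus F r) 0 with h0 | h0
  · exact h0.trans (Real.exp_pos _).le
  · exact (Real.log_le_iff_le_exp h0).mp hlog

/-- With `α < σ < σ' < ⌊α⌋ + 1` one has `log M(r) ≤ C * r ^ σ ≤ r ^ σ'` for large `r`, the second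
exponent absorbing the constant. -/
theorem IsZetaSequence.growthOrder_hadamardProduct_lt (ha : IsZetaSequence a α) :
    growthOrder (hadamardProduct ⌊α⌋₊ a) < ((⌊α⌋₊ + 1 : ℝ) : EReal) := by
  obtain ⟨σ', hασ', hσ'⟩ := exists_between (Nat.lt_floor_add_one α)
  obtain ⟨σ, hασ, hσσ'⟩ := exists_between hασ'
  obtain ⟨C, hC, hH⟩ := ha.exists_norm_hadamardProduct_le hασ (hσσ'.trans hσ').le
  refine lt_of_le_of_lt (b := (σ' : EReal)) ?_ (by exact_mod_cast hσ')
  refine limsup_le_of_le (by isBoundedDefault) ?_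
  filter_upwards [(tendsto_rpow_atTop (sub_pos.mpr hσσ')).eventually_ge_atTop C,
    eventually_gt_atTop 1] with r hr h1
  have hr0 : 0 < r := by linarith
  set M := maxModulus (hadamardProduct ⌊α⌋₊ a) r
  -- `M(r) ≥ |H 0| = 1` by the maximum principle, so `log M(r)` is never negative and a small
  -- value of `M(r)` cannot make `log (log M(r))` large
  have hM1 : 1 ≤ M := by
    have := norm_le_maxModulus_of_norm_le ha.differentiable_hadamardProduct (z := 0) hr0
      (by simpa using hr0.le)
    simpa [hadamardProduct, elementaryFactor_zero_right] using this
  have hM : Real.log M ≤ r ^ σ' := by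
    rw [Real.log_le_iff_le_exp (by linarith)]
    refine csSup_le ((NormedSpace.sphere_nonempty.mpr hr0.le).image _) ?_
    rintro _ ⟨z, hz, rfl⟩
    have hz : ‖z‖ = r := by simpa using hz
    refine (hH z).trans (Real.exp_le_exp.mpr ?_)
    rw [hz]
    calc C * r ^ σ ≤ r ^ (σ' - σ) * r ^ σ := by gcongr
      _ = r ^ σ' := by rw [← Real.rpow_add hr0]; ring_nf
  rw [EReal.coe_le_coe_iff, div_le_iff₀ (Real.log_pos h1), ← Real.log_rpow hr0]
  -- if `log M(r) = 0` then `Real.log 0 = 0` still obeys the bound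
  rcases (Real.log_nonneg hM1).eq_or_lt with h0 | h0
  · rw [← h0, Real.log_zero]
    exact Real.log_nonneg (Real.one_le_rpow h1.le
      (ha.exponent_nonneg.trans hασ'.le))
  · exact Real.log_le_log h0 hM

/-! ### Borel–Carathéodory estimate for logarithmic derivatives -/

theorem logDeriv_differentiableOn_ball {g : ℂ → ℂ} {R : ℝ}
    (hg : DifferentiableOn ℂ g (Metric.ball 0 R)) (h0 : ∀ z ∈ Metric.ball (0 : ℂ) R, g z ≠ 0) :
    DifferentiableOn ℂ (logDeriv g) (Metric.ball 0 R) :=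
  (hg.deriv Metric.isOpen_ball).div hg h0

/-- Borel–Carathéodory for the Taylor coefficients of the logarithmic derivative: a zero-free `g`
has a logarithm on the disc whose real part is at most `M` after normalisation, so the logarithm is
at most `2 * M` on the disc of half the radius, and Cauchy's estimate applies there. -/
theorem norm_iteratedDeriv_logDeriv_le {g : ℂ → ℂ} {R M : ℝ} (hR : 0 < R) (hM : 0 < M)
    (hg : DifferentiableOn ℂ g (Metric.ball 0 R)) (h0 : ∀ z ∈ Metric.ball (0 : ℂ) R, g z ≠ 0)
    (hgM : ∀ z ∈ Metric.ball (0 : ℂ) R, ‖g z‖ ≤ ‖g 0‖ * Real.exp M) (m : ℕ) :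
    ‖iteratedDeriv m (logDeriv g) 0‖ ≤ (m + 1).factorial * (2 * M) / (R / 2) ^ (m + 1) := by
  have hmem : (0 : ℂ) ∈ Metric.ball (0 : ℂ) R := Metric.mem_ball_self hR
  obtain ⟨l, hl0, hl⟩ :=
    (logDeriv_differentiableOn_ball hg h0).isExactOn_ball.with_val_at 0 0
  have hld : DifferentiableOn ℂ l (Metric.ball 0 R) :=
    fun z hz => (hl z hz).differentiableAt.differentiableWithinAt
  have hexp : ∀ z ∈ Metric.ball (0 : ℂ) R, g z = g 0 * Complex.exp (l z) := by
    intro z hz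
    -- `g * exp (-l)` has vanishing derivative, hence is constant on the disc
    have hder : ∀ w ∈ Metric.ball (0 : ℂ) R,
        HasDerivAt (fun w => g w * Complex.exp (-l w)) 0 w := by
      intro w hw
      have hgw := (hg.differentiableAt (Metric.isOpen_ball.mem_nhds hw)).hasDerivAt
      refine (hgw.mul (hl w hw).neg.cexp).congr_deriv ?_
      rw [logDeriv_apply]
      field_simp [h0 w hw]
      ring
    have := Metric.isOpen_ball.is_const_of_deriv_eq_zero
      (convex_ball (0 : ℂ) R).isPreconnected
      (fun w hw => (hder w hw).differentiableAt.differentiableWithinAt)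
      (fun w hw => (hder w hw).deriv) hz hmem
    simp only [hl0, neg_zero, Complex.exp_zero, mul_one] at this
    rw [← this, mul_assoc, ← Complex.exp_add, neg_add_cancel, Complex.exp_zero, mul_one]
  have hre : Set.MapsTo l (Metric.ball 0 R) {z | z.re ≤ M} := by
    intro z hz
    have h1 := hgM z hz
    rw [hexp z hz, norm_mul, Complex.norm_exp] at h1
    exact Real.exp_le_exp.mp (le_of_mul_le_mul_left h1 (norm_pos_iff.mpr (h0 0 hmem)))
  have hsub : Metric.closedBall (0 : ℂ) (R / 2) ⊆ Metric.ball 0 R :=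
    Metric.closedBall_subset_ball (by linarith)
  have hbound : ∀ z ∈ Metric.sphere (0 : ℂ) (R / 2), ‖l z‖ ≤ 2 * M := by
    intro z hz
    refine (Complex.borelCaratheodory_zero hM hld hre hR
      (hsub (Metric.sphere_subset_closedBall hz)) hl0).trans_eq ?_
    have : ‖z‖ = R / 2 := by simpa using hz
    rw [this]
    field_simp
    ring
  have hderiv : iteratedDeriv m (logDeriv g) 0 = iteratedDeriv (m + 1) l 0 := by
    rw [iteratedDeriv_succ']
    refine Filter.EventuallyEq.iteratedDeriv_eq m ?_
    filter_upwards [Metric.isOpen_ball.mem_nhds hmem] with z hz using (hl z hz).deriv.symm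
  rw [hderiv]
  exact Complex.norm_iteratedDeriv_le_of_forall_mem_sphere_norm_le (m + 1) (by linarith)
    (hld.mono (closure_ball (0 : ℂ) (by linarith : R / 2 ≠ 0) ▸ hsub)).diffContOnCl hbound

/-! ### Dividing out finitely many zeros -/

variable {F : ℂ → ℂ}

/-- The first `N` zeros can be divided out, the quotient having exactly the remaining ones. -/
theorem IsCharacteristicFunction.exists_eq_prod_mul (hF : IsCharacteristicFunction F a) (N : ℕ) :
    ∃ g : ℂ → ℂ, Differentiable ℂ g ∧
      (∀ z, F z = (∏ k ∈ Finset.range N, (z - a k)) * g z) ∧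
      ∀ z, analyticOrderAt g z = {k | N ≤ k ∧ a k = z}.encard := by
  induction N with
  | zero => exact ⟨F, hF.entire, by simp, by simpa using hF.zeros⟩
  | succ N ih =>
    obtain ⟨g, hg, hFg, hord⟩ := ih
    have hgN : g (a N) = 0 := by
      refine apply_eq_zero_of_analyticOrderAt_ne_zero ?_
      rw [hord]
      exact Set.encard_ne_zero.mpr ⟨N, le_rfl, rfl⟩
    have hfac : ∀ z, g z = (z - a N) * dslope g (a N) z := fun z => by
      simpa [hgN] using (sub_smul_dslope g (a N) z).symm
    have hd : Differentiable ℂ (dslope g (a N)) := by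
      rw [← differentiableOn_univ, Complex.differentiableOn_dslope univ_mem]
      exact hg.differentiableOn
    refine ⟨dslope g (a N), hd, fun z => ?_, fun z => ?_⟩
    · rw [Finset.prod_range_succ, mul_assoc, ← hfac, hFg]
    · have hmul : analyticOrderAt g z
          = analyticOrderAt (· - a N) z + analyticOrderAt (dslope g (a N)) z := by
        rw [← analyticOrderAt_mul (by fun_prop) (hd.analyticAt z)]
        exact congrArg (analyticOrderAt · z) (funext hfac)
      rw [hord] at hmul
      by_cases hz : z = a N
      · subst hz
        have hset : {k | N ≤ k ∧ a k = a N} = insert N {k | N + 1 ≤ k ∧ a k = a N} := by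
          ext k
          simp only [Set.mem_ofPred_eq, Set.mem_insert_iff]
          grind
        rw [hset, Set.encard_insert_of_notMem (by simp), analyticOrderAt_id_sub_const_self,
          add_comm] at hmul
        exact (WithTop.add_left_cancel ENat.one_ne_top hmul).symm
      · have hset : {k | N ≤ k ∧ a k = z} = {k | N + 1 ≤ k ∧ a k = z} := by
          ext k
          simp only [Set.mem_ofPred_eq]
          grind
        rw [hset, analyticOrderAt_id_sub_const_of_ne hz, zero_add] at hmul
        exact hmul.symm

theorem iteratedDeriv_inv_sub_zero (m : ℕ) (w : ℂ) :
    iteratedDeriv m (fun z => (z - w)⁻¹) 0 = -(m.factorial * (w ^ (m + 1))⁻¹) := by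
  have h := congrFun (iter_deriv_inv_linear_sub m (1 : ℂ) w) 0
  simp only [one_mul, one_pow, mul_one, zero_sub] at h
  rw [iteratedDeriv_eq_iterate, h, show (-1 - (m : ℤ)) = -((m + 1 : ℕ) : ℤ) by push_cast; ring,
    zpow_neg, zpow_natCast, neg_pow w, mul_inv, pow_succ (-1 : ℂ), mul_inv, ← inv_pow]
  have : ((-1 : ℂ) ^ m) * ((-1)⁻¹) ^ m = 1 := by rw [← mul_pow]; norm_num
  linear_combination (-(m.factorial * (w ^ (m + 1))⁻¹) : ℂ) * this

theorem IsCharacteristicFunction.ne_zero_of_mem_ball (ha : IsZetaSequence a α)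
    (hF : IsCharacteristicFunction F a) {z : ℂ} (hz : z ∈ Metric.ball 0 ‖a 0‖) : F z ≠ 0 := by
  have hz : ‖z‖ < ‖a 0‖ := by simpa using hz
  have h : analyticOrderAt F z = 0 := by
    rw [hF.zeros, Set.encard_eq_zero, Set.eq_empty_iff_forall_notMem]
    rintro k rfl
    exact absurd (ha.mono (Nat.zero_le k)) (not_le.mpr hz)
  exact (hF.entire.analyticAt z).analyticOrderAt_eq_zero.mp h

theorem IsCharacteristicFunction.differentiableOn_logDeriv (ha : IsZetaSequence a α)
    (hF : IsCharacteristicFunction F a) :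
    DifferentiableOn ℂ (logDeriv F) (Metric.ball 0 ‖a 0‖) :=
  logDeriv_differentiableOn_ball hF.entire.differentiableOn fun _ hz =>
    hF.ne_zero_of_mem_ball ha hz

/-- After removing the zeros `a_0, …, a_{N-1}`, the remaining factor is zero-free on
`|z| < |a_N|`. It is controlled there by the maximum modulus of `F` on the circle of radius
`2 * |a_N|`, on which each removed factor `z - a_k` is at least as large as it is at the origin. -/
theorem IsCharacteristicFunction.norm_sum_add_iteratedDeriv_le (ha : IsZetaSequence a α)
    (hF : IsCharacteristicFunction F a) (N m : ℕ) {M : ℝ} (hM : 0 < M)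
    (hFM : maxModulus F (2 * ‖a N‖) ≤ ‖F 0‖ * Real.exp M) :
    ‖m.factorial * ∑ k ∈ Finset.range N, (a k ^ (m + 1))⁻¹ + iteratedDeriv m (logDeriv F) 0‖
      ≤ (m + 1).factorial * (2 * M) / (‖a N‖ / 2) ^ (m + 1) := by
  obtain ⟨g, hg, hFg, hord⟩ := hF.exists_eq_prod_mul N
  have hR := ha.norm_pos N
  have hg0 : ∀ z ∈ Metric.ball (0 : ℂ) ‖a N‖, g z ≠ 0 := by
    intro z hz
    have hz : ‖z‖ < ‖a N‖ := by simpa using hz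
    refine (hg.analyticAt z).analyticOrderAt_eq_zero.mp ?_
    rw [hord, Set.encard_eq_zero, Set.eq_empty_iff_forall_notMem]
    rintro k ⟨hk, rfl⟩
    exact absurd (ha.mono hk) (not_le.mpr hz)
  have hsphere : ∀ z ∈ Metric.sphere (0 : ℂ) (2 * ‖a N‖), ‖g z‖ ≤ ‖g 0‖ * Real.exp M := by
    intro z hz
    have hz : ‖z‖ = 2 * ‖a N‖ := by simpa using hz
    set P : ℝ := ∏ k ∈ Finset.range N, ‖a k‖
    have hP : 0 < P := Finset.prod_pos fun k _ => ha.norm_pos k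
    have hPz : P ≤ ‖∏ k ∈ Finset.range N, (z - a k)‖ := by
      rw [norm_prod]
      refine Finset.prod_le_prod (fun _ _ => norm_nonneg _) fun k hk => ?_
      have h1 : ‖a k‖ ≤ ‖a N‖ := ha.mono (Finset.mem_range.mp hk).le
      have h2 := norm_sub_norm_le z (a k)
      linarith
    have hF0 : ‖F 0‖ = P * ‖g 0‖ := by simp [hFg, P]
    have hz' : P * ‖g z‖ ≤ P * (‖g 0‖ * Real.exp M) :=
      calc P * ‖g z‖ ≤ ‖∏ k ∈ Finset.range N, (z - a k)‖ * ‖g z‖ := by gcongr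
        _ = ‖F z‖ := by rw [hFg, norm_mul]
        _ ≤ maxModulus F (2 * ‖a N‖) := hz ▸ norm_le_maxModulus hF.entire.continuous z
        _ ≤ P * (‖g 0‖ * Real.exp M) := by rw [← mul_assoc, ← hF0]; exact hFM
    exact le_of_mul_le_mul_left hz' hP
  -- by the maximum principle the bound passes from the circle to the smaller disc
  have hball : ∀ z ∈ Metric.ball (0 : ℂ) ‖a N‖, ‖g z‖ ≤ ‖g 0‖ * Real.exp M := by
    intro z hz
    have hz : ‖z‖ < ‖a N‖ := by simpa using hz
    refine Complex.norm_le_of_forall_mem_frontier_norm_le (U := Metric.ball 0 (2 * ‖a N‖))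
      Metric.isBounded_ball hg.diffContOnCl (fun w hw => hsphere w ?_) (subset_closure ?_)
    · rwa [frontier_ball _ (by positivity)] at hw
    · simp only [mem_ball_zero_iff]
      linarith
  have hlog : logDeriv F =ᶠ[𝓝 0]
      fun z => (∑ k ∈ Finset.range N, (z - a k)⁻¹) + logDeriv g z := by
    filter_upwards [Metric.isOpen_ball.mem_nhds (Metric.mem_ball_self (x := (0 : ℂ)) ha.pos)]
      with z hz
    have hne : ∀ k, z - a k ≠ 0 := by
      intro k hk
      obtain rfl : z = a k := sub_eq_zero.mp hk
      have hz : ‖a k‖ < ‖a 0‖ := by simpa using hz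
      exact absurd (ha.mono (Nat.zero_le k)) (not_le.mpr hz)
    rw [show F = fun z => (∏ k ∈ Finset.range N, (z - a k)) * g z from funext hFg,
      logDeriv_mul z (Finset.prod_ne_zero_iff.mpr fun k _ => hne k)
        (hg0 z (Metric.ball_subset_ball (ha.mono (Nat.zero_le N)) hz))
        (by fun_prop) (hg z),
      logDeriv_prod (fun k _ => hne k) (fun k _ => by fun_prop)]
    congr 1
    refine Finset.sum_congr rfl fun k _ => ?_
    simp [logDeriv_apply]
  have hinv : ∀ k ∈ Finset.range N, ContDiffAt ℂ m (fun z => (z - a k)⁻¹) 0 := fun k _ =>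
    (contDiffAt_id.sub contDiffAt_const).inv (by simpa using ha.ne_zero k)
  have hlg : ContDiffAt ℂ m (logDeriv g) 0 :=
    ((logDeriv_differentiableOn_ball hg.differentiableOn hg0).analyticAt
      (Metric.isOpen_ball.mem_nhds (Metric.mem_ball_self hR))).contDiffAt
  have heq : m.factorial * ∑ k ∈ Finset.range N, (a k ^ (m + 1))⁻¹
      + iteratedDeriv m (logDeriv F) 0 = iteratedDeriv m (logDeriv g) 0 := by
    rw [hlog.iteratedDeriv_eq, iteratedDeriv_fun_add (ContDiffAt.sum hinv) hlg,
      iteratedDeriv_fun_sum hinv,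
      Finset.sum_congr rfl fun k _ => iteratedDeriv_inv_sub_zero m (a k),
      Finset.sum_neg_distrib, Finset.mul_sum]
    ring
  rw [heq]
  exact norm_iteratedDeriv_logDeriv_le hR hM hg.differentiableOn hg0 hball m

/-! ### Power sums of the zeros -/

theorem IsZetaSequence.summable_inv_pow (ha : IsZetaSequence a α) {n : ℕ} (hn : α < n) :
    Summable fun k => (a k ^ n)⁻¹ := by
  refine Summable.of_norm ((ha.summable_rpow hn).congr fun k => ?_)
  rw [Real.rpow_neg (norm_nonneg _), Real.rpow_natCast, norm_inv, norm_pow]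

/-- The Taylor coefficients of the logarithmic derivative of index at least `⌊α⌋` are the negated
power sums: the deviation of the partial sums is
`O((log M(2 |a_N|) + 1) / |a_N| ^ (m + 1))`, and
`log M(r) ≤ r ^ β` for large `r`, with `β < m + 1`. -/
theorem IsCharacteristicFunction.iteratedDeriv_logDeriv_eq (ha : IsZetaSequence a α)
    (hF : IsCharacteristicFunction F a) (hord : HasMinimalOrder F a α) {m : ℕ}
    (hm : α < (m + 1 : ℕ)) :
    iteratedDeriv m (logDeriv F) 0 = -(m.factorial * ∑' k, (a k ^ (m + 1))⁻¹) := by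
  obtain ⟨β, hβ, hβm⟩ : ∃ β : ℝ, growthOrder F < (β : EReal) ∧ β < ((m + 1 : ℕ) : ℝ) := by
    have h := ha.growthOrder_hadamardProduct_lt
    rw [← hord] at h
    obtain ⟨β, h1, h2⟩ := EReal.lt_iff_exists_real_btwn.mp h
    refine ⟨β, h1, (EReal.coe_lt_coe_iff.mp h2).trans_le ?_⟩
    have : ⌊α⌋₊ < m + 1 := (Nat.floor_lt ha.exponent_nonneg).mpr hm
    exact_mod_cast this
  have hF0 : 0 < ‖F 0‖ := norm_pos_iff.mpr
    (hF.ne_zero_of_mem_ball ha (Metric.mem_ball_self ha.pos))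
  set K : ℝ := |Real.log ‖F 0‖|
  have h2a : Tendsto (fun N => 2 * ‖a N‖) atTop atTop := ha.tendsto.const_mul_atTop two_pos
  have hpos : ∀ N, 0 < 2 * ‖a N‖ := fun N => mul_pos two_pos (ha.norm_pos N)
  have hlim : Tendsto (fun N => (m + 1).factorial * (2 * ((2 * ‖a N‖) ^ β + K)) /
      (‖a N‖ / 2) ^ (m + 1)) atTop (𝓝 0) := by
    have h1 : Tendsto (fun N => (2 * ‖a N‖) ^ (-(((m + 1 : ℕ) : ℝ) - β))) atTop (𝓝 0) :=
      (tendsto_rpow_neg_atTop (sub_pos.mpr hβm)).comp h2a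
    have h2 : Tendsto (fun N => K / (2 * ‖a N‖) ^ (m + 1)) atTop (𝓝 0) :=
      tendsto_const_nhds.div_atTop ((tendsto_pow_atTop (by omega)).comp h2a)
    have h3 := (h1.add h2).const_mul ((m + 1).factorial * 2 * 4 ^ (m + 1) : ℝ)
    rw [add_zero, mul_zero] at h3
    refine h3.congr fun N => ?_
    have h4 : (‖a N‖ / 2) ^ (m + 1) = (2 * ‖a N‖) ^ (m + 1) / 4 ^ (m + 1) := by
      rw [← div_pow]; congr 1; ring
    rw [neg_sub, Real.rpow_sub (hpos N), Real.rpow_natCast, h4]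
    have := pow_ne_zero (m + 1) (hpos N).ne'
    field_simp
  have hzero : Tendsto (fun N => m.factorial * ∑ k ∈ Finset.range N, (a k ^ (m + 1))⁻¹
      + iteratedDeriv m (logDeriv F) 0) atTop (𝓝 0) := by
    refine squeeze_zero_norm' ?_ hlim
    filter_upwards [h2a.eventually (eventually_maxModulus_le hβ)] with N hN
    have hMpos : 0 < (2 * ‖a N‖) ^ β := Real.rpow_pos_of_pos (hpos N) _
    refine hF.norm_sum_add_iteratedDeriv_le ha N m
      (add_pos_of_pos_of_nonneg hMpos (abs_nonneg _)) (hN.trans ?_)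
    nth_rewrite 1 [← Real.exp_log hF0]
    rw [← Real.exp_add]
    refine Real.exp_le_exp.mpr ?_
    have := neg_abs_le (Real.log ‖F 0‖)
    change -K ≤ _ at this
    linarith
  have hsum := (((ha.summable_inv_pow hm).hasSum.tendsto_sum_nat).const_mul
    (m.factorial : ℂ)).add_const (iteratedDeriv m (logDeriv F) 0)
  have := tendsto_nhds_unique hsum hzero
  linear_combination this

/-! ### Taylor coefficients and the residue -/

theorem iteratedDeriv_zero_of_hasSum (hF : Differentiable ℂ F) {c : ℕ → ℂ}
    (hc : ∀ z : ℂ, HasSum (fun j : ℕ => c j * z ^ j) (F z)) (n : ℕ) :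
    iteratedDeriv n F 0 = n.factorial * c n := by
  have h1 : HasFPowerSeriesAt F (FormalMultilinearSeries.ofScalars ℂ c) 0 := by
    rw [hasFPowerSeriesAt_iff]
    refine Eventually.of_forall fun z => ?_
    simpa [FormalMultilinearSeries.coeff_ofScalars, mul_comm] using hc z
  have h2 := congrArg (fun p => FormalMultilinearSeries.coeff p n)
    (h1.eq_formalMultilinearSeries (hF.analyticAt 0).hasFPowerSeriesAt)
  simp only [FormalMultilinearSeries.coeff_ofScalars] at h2
  rw [h2, mul_div_cancel₀ _ (by exact_mod_cast n.factorial_ne_zero)]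

/-- Comparing coefficients in `F' = (F' / F) * F` yields the recurrence defining the `b_j`. -/
theorem iteratedDeriv_logDeriv_eq_sumRuleCoeff (hF : Differentiable ℂ F) (h0 : F 0 ≠ 0)
    {c : ℕ → ℂ} (hc : ∀ z : ℂ, HasSum (fun j : ℕ => c j * z ^ j) (F z)) (m : ℕ) :
    iteratedDeriv m (logDeriv F) 0 = m.factorial * ((m + 1 : ℕ) * sumRuleCoeff c (m + 1)) := by
  have hcoeff := iteratedDeriv_zero_of_hasSum hF hc
  have hc0 : c 0 ≠ 0 := by
    have := hcoeff 0
    simp only [iteratedDeriv_zero, Nat.factorial_zero, Nat.cast_one, one_mul] at this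
    exact this ▸ h0
  have hl : AnalyticAt ℂ (logDeriv F) 0 := (hF.analyticAt 0).deriv.div (hF.analyticAt 0) h0
  have hev : deriv F =ᶠ[𝓝 0] logDeriv F * F := by
    filter_upwards [hF.continuous.continuousAt.eventually_ne h0] with z hz
    rw [Pi.mul_apply, logDeriv_apply, div_mul_cancel₀ _ hz]
  induction m using Nat.strong_induction_on with
  | _ m ih =>
  have hmf : (m.factorial : ℂ) ≠ 0 := by exact_mod_cast m.factorial_ne_zero
  have hm1 : ((m + 1 : ℕ) : ℂ) ≠ 0 := by exact_mod_cast m.succ_ne_zero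
  have h1 := hcoeff (m + 1)
  rw [iteratedDeriv_succ', hev.iteratedDeriv_eq,
    iteratedDeriv_mul hl.contDiffAt hF.contDiff.contDiffAt, Finset.sum_range_succ] at h1
  have h2 : ∑ i ∈ Finset.range m, (m.choose i : ℂ) * iteratedDeriv i (logDeriv F) 0 *
      iteratedDeriv (m - i) F 0 = m.factorial *
        ∑ l ∈ Finset.Ico 1 (m + 1), (l : ℂ) * c (m + 1 - l) * sumRuleCoeff c l := by
    rw [Finset.sum_Ico_eq_sum_range, Finset.mul_sum, Nat.add_sub_cancel]
    refine Finset.sum_congr rfl fun i hi => ?_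
    have him := (Finset.mem_range.mp hi)
    have hch : (m.choose i : ℂ) * i.factorial * (m - i).factorial = m.factorial := by
      exact_mod_cast Nat.choose_mul_factorial_mul_factorial him.le
    rw [ih i him, hcoeff, add_comm 1 i, Nat.add_sub_add_right, ← hch]
    ring
  rw [h2, hcoeff, Nat.factorial_succ] at h1
  simp only [Nat.choose_self, Nat.cast_one, one_mul, Nat.sub_self, Nat.factorial_zero] at h1
  rw [sumRuleCoeff_eq]
  have h3 : ∑ l ∈ Finset.Ico 1 (m + 1), ((l : ℂ) / ((m + 1 : ℕ) : ℂ)) *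
      (c (m + 1 - l) / c 0) * sumRuleCoeff c l = (((m + 1 : ℕ) : ℂ) * c 0)⁻¹ *
        ∑ l ∈ Finset.Ico 1 (m + 1), (l : ℂ) * c (m + 1 - l) * sumRuleCoeff c l := by
    rw [Finset.mul_sum]
    refine Finset.sum_congr rfl fun l _ => ?_
    field_simp
  rw [h3]
  field_simp
  push_cast at h1 ⊢
  linear_combination h1

theorem IsZetaSequence.branchPow_neg (ha : IsZetaSequence a α) (Ψ : ℝ) (n : ℕ) :
    (fun k => branchPow Ψ (a k) (-(n : ℂ))) = fun k => (a k ^ n)⁻¹ :=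
  funext fun k => branchPow_neg_natCast Ψ (ha.ne_zero k) n

theorem IsZetaSequence.zeta_natCast (ha : IsZetaSequence a α) (Ψ : ℝ) (n : ℕ) :
    zeta Ψ a n = ∑' k, (a k ^ n)⁻¹ := by
  rw [zeta, ha.branchPow_neg]

/-- Cauchy's integral formula for `z ^ (-(m + 1)) * h z` with `h` holomorphic at the origin. -/
theorem hasResidueAt_zpow_mul {h : ℂ → ℂ} {ρ : ℝ} (hρ : 0 < ρ)
    (hh : DifferentiableOn ℂ h (Metric.ball 0 ρ)) (m : ℕ) :
    HasResidueAt (fun z => z ^ (-((m + 1 : ℕ) : ℤ)) * h z) 0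
      (iteratedDeriv m h 0 / m.factorial) := by
  refine ⟨ρ, hρ, ?_, fun r hr hrρ => ?_⟩
  · refine DifferentiableOn.mul (fun z hz => ?_) (hh.mono Set.sdiff_subset)
    exact (differentiableAt_zpow.mpr (Or.inl hz.2)).differentiableWithinAt
  · have := (hh.mono (Metric.closedBall_subset_ball hrρ)).circleIntegral_one_div_sub_center_pow_smul
      hr m
    simp only [sub_zero, smul_eq_mul, one_div] at this
    simp only [zpow_neg, zpow_natCast]
    rw [this]
    have := Complex.two_pi_I_ne_zero
    field_simp

end ZetaSumRules

open ZetaSumRules in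
theorem mainTheorem2 (a : ℕ → ℂ) (α : ℝ) (ha : IsZetaSequence a α) (Ψ : ℝ)
    (F : ℂ → ℂ) (hF : IsCharacteristicFunction F a) (hord : HasMinimalOrder F a α)
    (c : ℕ → ℂ) (hc : ∀ z : ℂ, HasSum (fun j : ℕ => c j * z ^ j) (F z)) :
    (∀ n : ℕ, α < n →
      Summable (fun k => branchPow Ψ (a k) (-(n : ℂ))) ∧
      HasResidueAt (fun z => z ^ (-(n : ℤ)) * (deriv F z / F z)) 0 (-zeta Ψ a n) ∧
      zeta Ψ a n = -(n : ℂ) * sumRuleCoeff c n ∧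
      zeta Ψ a n = -(n : ℂ) * (c n / c 0)
        - ∑ l ∈ Finset.Ico (⌊α⌋₊ + 1) n, c (n - l) / c 0 * zeta Ψ a l
        + ∑ l ∈ Finset.Icc 1 ⌊α⌋₊, (l : ℂ) * (c (n - l) / c 0) * sumRuleCoeff c l) ∧
    (α < 1 → ∀ n : ℕ, 1 ≤ n →
      zeta Ψ a n = -(n : ℂ) * (c n / c 0)
        - ∑ l ∈ Finset.Ico 1 n, c (n - l) / c 0 * zeta Ψ a l) := by
  have hα := ha.exponent_nonneg
  have h0 : F 0 ≠ 0 := hF.ne_zero_of_mem_ball ha (Metric.mem_ball_self ha.pos)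
  have hderiv : ∀ m : ℕ, α < (m + 1 : ℕ) →
      iteratedDeriv m (logDeriv F) 0 / m.factorial = -zeta Ψ a (m + 1 : ℕ) := by
    intro m hm
    have hmf : (m.factorial : ℂ) ≠ 0 := by exact_mod_cast m.factorial_ne_zero
    rw [hF.iteratedDeriv_logDeriv_eq ha hord hm, ha.zeta_natCast, neg_div,
      mul_div_cancel_left₀ _ hmf]
  have hzeta : ∀ n : ℕ, α < n → zeta Ψ a n = -(n : ℂ) * sumRuleCoeff c n := by
    intro n hn
    obtain ⟨m, rfl⟩ : ∃ m, n = m + 1 :=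
      Nat.exists_eq_add_one.mpr (by exact_mod_cast hα.trans_lt hn)
    have hmf : (m.factorial : ℂ) ≠ 0 := by exact_mod_cast m.factorial_ne_zero
    have h := hderiv m hn
    rw [iteratedDeriv_logDeriv_eq_sumRuleCoeff hF.entire h0 hc, mul_div_cancel_left₀ _ hmf] at h
    rw [neg_mul, h, neg_neg]
  have hrec : ∀ n : ℕ, α < n → zeta Ψ a n = -(n : ℂ) * (c n / c 0)
      - ∑ l ∈ Finset.Ico (⌊α⌋₊ + 1) n, c (n - l) / c 0 * zeta Ψ a l
      + ∑ l ∈ Finset.Icc 1 ⌊α⌋₊, (l : ℂ) * (c (n - l) / c 0) * sumRuleCoeff c l := by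
    intro n hn
    have hfl : ⌊α⌋₊ + 1 ≤ n := (Nat.floor_lt hα).mpr hn
    have hn0 : (n : ℂ) ≠ 0 := by exact_mod_cast (by omega : n ≠ 0)
    have h1 : ∑ l ∈ Finset.Ico (⌊α⌋₊ + 1) n, c (n - l) / c 0 * zeta Ψ a l =
        -∑ l ∈ Finset.Ico (⌊α⌋₊ + 1) n, (l : ℂ) * (c (n - l) / c 0) * sumRuleCoeff c l := by
      rw [← Finset.sum_neg_distrib]
      refine Finset.sum_congr rfl fun l hl => ?_
      rw [hzeta l ((Nat.floor_lt hα).mp (Finset.mem_Ico.mp hl).1)]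
      ring
    have h2 : (n : ℂ) * ∑ l ∈ Finset.Ico 1 n, ((l : ℂ) / (n : ℂ)) * (c (n - l) / c 0) *
        sumRuleCoeff c l =
          ∑ l ∈ Finset.Ico 1 n, (l : ℂ) * (c (n - l) / c 0) * sumRuleCoeff c l := by
      rw [Finset.mul_sum]
      refine Finset.sum_congr rfl fun l _ => ?_
      rw [← mul_assoc, ← mul_assoc, mul_div_cancel₀ _ hn0]
    rw [hzeta n hn, sumRuleCoeff_eq, mul_sub, neg_mul, neg_mul, h2, h1,
      ← Finset.Ico_add_one_right_eq_Icc,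
      ← Finset.sum_Ico_consecutive _ (Nat.le_add_left 1 ⌊α⌋₊) hfl]
    ring
  refine ⟨fun n hn => ⟨?_, ?_, hzeta n hn, hrec n hn⟩, fun h1 n hn => ?_⟩
  · rw [ha.branchPow_neg]
    exact ha.summable_inv_pow hn
  · obtain ⟨m, rfl⟩ : ∃ m, n = m + 1 :=
      Nat.exists_eq_add_one.mpr (by exact_mod_cast hα.trans_lt hn)
    rw [← hderiv m hn]
    exact hasResidueAt_zpow_mul ha.pos (hF.differentiableOn_logDeriv ha) m
  · have hfl : ⌊α⌋₊ = 0 := Nat.floor_eq_zero.mpr h1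
    have := hrec n (h1.trans_le (by exact_mod_cast hn))
    rw [hfl] at this
    simpa using this
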